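/- Call a continuous, non-decreasing, convex function $M:[0,\infty)\to[0,\infty)$ with $M(0)=0$ and $\lim_{t\to\infty}M(t)=\infty$ an \emph{Orlicz function}; it is \emph{non-degenerate} if $M(t)>0$ for all $t>0$. Let $\ell_M$ be the space of all real sequences $a=(a_n)$ with $\sum_n M(|a_n|/\rho)<\infty$ for some $\rho>0$, with the norm $$\|a\|=\inf\Bigl\{\rho>0:\sum_n M(|a_n|/\rho)\le 1\Bigr\},$$ and let $h_M$ be the closed linear span in $\ell_M$ of the unit vectors $e_n$. A real Banach space is \emph{polyhedral} if the closed unit ball of each of its finite-dimensional subspaces is a polyhedron (an intersection of finitely many closed half-spaces), and a space is \emph{isomorphically polyhedral} if it is isomorphic (linearly homeomorphic) to a polyhedral Banach space. \textbf{Theorem.} Let $M$ be a non-degenerate Orlicz function for which there is a finite $K>0$ with $$\lim_{t\to 0^+}\frac{M(Kt)}{M(t)}=\infty.$$ Then $h_M$ is isomorphically polyhedral. -/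

import Mathlib

open Filter Topology

universe u

/-! ## Polyhedral spaces -/

/-- A polyhedron: the intersection of finitely many closed half-spaces `{x | f x ≤ c}`. -/
def IsPolyhedron {Y : Type u} [NormedAddCommGroup Y] [NormedSpace ℝ Y] (s : Set Y) : Prop :=
  ∃ H : Finset ((Y →L[ℝ] ℝ) × ℝ), s = {x | ∀ p ∈ H, p.1 x ≤ p.2}

/-- The closed unit ball of every finite-dimensional subspace is a polyhedron. -/
def IsPolyhedralSpace (X : Type u) [NormedAddCommGroup X] [NormedSpace ℝ X] : Prop :=
  ∀ Y : Submodule ℝ X, FiniteDimensional ℝ Y → IsPolyhedron (Metric.closedBall (0 : Y) 1)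

/-- `E` is linearly homeomorphic to a polyhedral Banach space. -/
def IsIsomorphicallyPolyhedral (E : Type u) [NormedAddCommGroup E] [NormedSpace ℝ E] : Prop :=
  ∃ (X : Type u) (_ : NormedAddCommGroup X) (_ : NormedSpace ℝ X),
    CompleteSpace X ∧ IsPolyhedralSpace X ∧ Nonempty (E ≃L[ℝ] X)

/-! ## Orlicz functions -/

/-- An Orlicz function; only the values at `t ≥ 0` matter, the values at `t < 0` are unconstrained
and never used. -/
structure OrliczFunction where
  toFun : ℝ → ℝ
  continuousOn : ContinuousOn toFun (Set.Ici 0)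
  monotoneOn : MonotoneOn toFun (Set.Ici 0)
  convexOn : ConvexOn ℝ (Set.Ici 0) toFun
  map_zero : toFun 0 = 0
  tendsto_atTop : Tendsto toFun atTop atTop

namespace OrliczFunction

instance : CoeFun OrliczFunction (fun _ => ℝ → ℝ) := ⟨OrliczFunction.toFun⟩

/-- `M t > 0` for all `t > 0`. -/
def NonDegenerate (M : OrliczFunction) : Prop := ∀ t : ℝ, 0 < t → 0 < M t

variable (M : OrliczFunction)

theorem nonneg {t : ℝ} (ht : 0 ≤ t) : 0 ≤ M t := by
  have h := M.monotoneOn (Set.mem_Ici.2 le_rfl) (Set.mem_Ici.2 ht) ht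
  rwa [M.map_zero] at h

theorem mono {s t : ℝ} (hs : 0 ≤ s) (h : s ≤ t) : M s ≤ M t :=
  M.monotoneOn (Set.mem_Ici.2 hs) (Set.mem_Ici.2 (hs.trans h)) h

theorem map_mul_le {c t : ℝ} (hc : 0 ≤ c) (hc1 : c ≤ 1) (ht : 0 ≤ t) : M (c * t) ≤ c * M t := by
  have h := M.convexOn.2 (Set.mem_Ici.2 ht) (Set.mem_Ici.2 (le_refl (0 : ℝ))) hc
    (sub_nonneg.2 hc1) (by ring)
  simpa [M.map_zero] using h

/-- Convexity, in the form that gives the triangle inequality of the Luxemburg norm. -/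
theorem map_add_div_le {a b r s : ℝ} (hr : 0 < r) (hs : 0 < s) :
    M (|a + b| / (r + s)) ≤ r / (r + s) * M (|a| / r) + s / (r + s) * M (|b| / s) := by
  have hrs : 0 < r + s := add_pos hr hs
  have h := M.convexOn.2 (Set.mem_Ici.2 (div_nonneg (abs_nonneg a) hr.le))
    (Set.mem_Ici.2 (div_nonneg (abs_nonneg b) hs.le)) (div_nonneg hr.le hrs.le)
    (div_nonneg hs.le hrs.le) (by field_simp)
  simp only [smul_eq_mul] at h
  refine le_trans (M.mono (by positivity) ?_) h
  have e : r / (r + s) * (|a| / r) + s / (r + s) * (|b| / s) = (|a| + |b|) / (r + s) := by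
    field_simp
  rw [e]
  exact div_le_div_of_nonneg_right (abs_add_le a b) hrs.le

/-- `∑ M(|aₙ|/ρ) < ∞`; the terms are nonnegative for `ρ > 0`. -/
def SummableAt (ρ : ℝ) (a : ℕ → ℝ) : Prop := Summable fun n => M (|a n| / ρ)

variable {M}

theorem term_nonneg {ρ : ℝ} (hρ : 0 < ρ) (a : ℕ → ℝ) (n : ℕ) : 0 ≤ M (|a n| / ρ) :=
  M.nonneg (div_nonneg (abs_nonneg _) hρ.le)

theorem SummableAt.add {r s : ℝ} {a b : ℕ → ℝ} (hr : 0 < r) (hs : 0 < s)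
    (ha : M.SummableAt r a) (hb : M.SummableAt s b) : M.SummableAt (r + s) (a + b) :=
  Summable.of_nonneg_of_le (fun n => term_nonneg (add_pos hr hs) (a + b) n)
    (fun _ => M.map_add_div_le hr hs) ((ha.mul_left _).add (hb.mul_left _))

theorem abs_smul_div (c ρ : ℝ) (hc : c ≠ 0) (a : ℕ → ℝ) (n : ℕ) :
    |(c • a) n| / (|c| * ρ) = |a n| / ρ := by
  rw [Pi.smul_apply, smul_eq_mul, abs_mul, mul_div_mul_left _ _ (abs_ne_zero.2 hc)]

variable (M)

/-! ## The Orlicz sequence space -/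

/-- The linear space of real sequences with `∑ M(|aₙ|/ρ) < ∞` for some `ρ > 0`. -/
def ellSubmodule : Submodule ℝ (ℕ → ℝ) where
  carrier := {a | ∃ ρ : ℝ, 0 < ρ ∧ M.SummableAt ρ a}
  zero_mem' := ⟨1, one_pos, by simp [SummableAt, M.map_zero]⟩
  add_mem' := by
    rintro a b ⟨r, hr, ha⟩ ⟨s, hs, hb⟩
    exact ⟨r + s, add_pos hr hs, ha.add hr hs hb⟩
  smul_mem' := by
    rintro c a ⟨r, hr, ha⟩
    rcases eq_or_ne c 0 with rfl | hc
    · exact ⟨1, one_pos, by simp [SummableAt, M.map_zero]⟩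
    · refine ⟨|c| * r, mul_pos (abs_pos.2 hc) hr, ?_⟩
      simpa only [SummableAt, abs_smul_div c r hc a] using ha

/-- The Orlicz sequence space `ℓ_M`. It is a type of its own, so that it carries only the norm
topology and not the topology of pointwise convergence. -/
def Ell : Type := M.ellSubmodule

instance : AddCommGroup M.Ell := inferInstanceAs (AddCommGroup M.ellSubmodule)

instance : Module ℝ M.Ell := inferInstanceAs (Module ℝ M.ellSubmodule)

/-- The sequence underlying an element of `ℓ_M`. -/
def Ell.seq : M.Ell →ₗ[ℝ] (ℕ → ℝ) := M.ellSubmodule.subtype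

theorem Ell.seq_injective : Function.Injective (Ell.seq M) := Subtype.val_injective

theorem Ell.exists_summableAt (x : M.Ell) : ∃ ρ : ℝ, 0 < ρ ∧ M.SummableAt ρ (Ell.seq M x) :=
  x.2

/-- The set of `ρ > 0` with `∑ M(|aₙ|/ρ) ≤ 1`. -/
def admissible (a : ℕ → ℝ) : Set ℝ :=
  {ρ : ℝ | 0 < ρ ∧ M.SummableAt ρ a ∧ ∑' n, M (|a n| / ρ) ≤ 1}

/-- The Luxemburg norm `‖a‖ = inf {ρ > 0 : ∑ M(|aₙ|/ρ) ≤ 1}`. -/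
noncomputable instance : Norm M.Ell := ⟨fun x => sInf (M.admissible (Ell.seq M x))⟩

theorem Ell.norm_def (x : M.Ell) : ‖x‖ = sInf (M.admissible (Ell.seq M x)) := rfl

theorem admissible_bddBelow (a : ℕ → ℝ) : BddBelow (M.admissible a) := ⟨0, fun _ h => h.1.le⟩

theorem Ell.admissible_nonempty (x : M.Ell) : (M.admissible (Ell.seq M x)).Nonempty := by
  obtain ⟨r, hr, hs⟩ := Ell.exists_summableAt M x
  set a := Ell.seq M x
  set S := ∑' n, M (|a n| / r) with hS
  have hS0 : 0 ≤ S := tsum_nonneg (term_nonneg hr a)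
  have hc : 0 < S + 1 := by linarith
  have hle : ∀ n, M (|a n| / (r * (S + 1))) ≤ (S + 1)⁻¹ * M (|a n| / r) := fun n => by
    have h := M.map_mul_le (inv_nonneg.2 hc.le) (inv_le_one_of_one_le₀ (by linarith))
      (div_nonneg (abs_nonneg (a n)) hr.le)
    have e : |a n| / (r * (S + 1)) = (S + 1)⁻¹ * (|a n| / r) := by field_simp
    rwa [e]
  have hρ : 0 < r * (S + 1) := mul_pos hr hc
  have hs' : M.SummableAt (r * (S + 1)) a :=
    Summable.of_nonneg_of_le (term_nonneg hρ a) hle (hs.mul_left _)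
  refine ⟨r * (S + 1), hρ, hs', (hs'.tsum_le_tsum hle (hs.mul_left _)).trans ?_⟩
  rw [tsum_mul_left, ← hS, inv_mul_le_iff₀ hc]
  linarith

theorem Ell.norm_nonneg' (x : M.Ell) : 0 ≤ ‖x‖ := Real.sInf_nonneg fun _ h => h.1.le

theorem Ell.norm_add_le' (x y : M.Ell) : ‖x + y‖ ≤ ‖x‖ + ‖y‖ := by
  refine le_of_forall_pos_lt_add fun ε hε => ?_
  obtain ⟨r, ⟨hr, hrs, hr1⟩, hrlt⟩ :=
    exists_lt_of_csInf_lt (Ell.admissible_nonempty M x)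
      (lt_add_of_pos_right (sInf (M.admissible (Ell.seq M x))) (half_pos hε))
  obtain ⟨s, ⟨hs, hss, hs1⟩, hslt⟩ :=
    exists_lt_of_csInf_lt (Ell.admissible_nonempty M y)
      (lt_add_of_pos_right (sInf (M.admissible (Ell.seq M y))) (half_pos hε))
  have hrs0 : 0 < r + s := add_pos hr hs
  have hsum := SummableAt.add hr hs hrs hss
  have hle : ‖x + y‖ ≤ r + s := by
    refine csInf_le (M.admissible_bddBelow _) ?_
    rw [map_add]
    refine ⟨hrs0, hsum, (hsum.tsum_le_tsum (fun n => M.map_add_div_le hr hs)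
      ((hrs.mul_left _).add (hss.mul_left _))).trans ?_⟩
    rw [(hrs.mul_left _).tsum_add (hss.mul_left _), tsum_mul_left, tsum_mul_left]
    have h1 := mul_le_mul_of_nonneg_left hr1 (div_nonneg hr.le hrs0.le)
    have h2 := mul_le_mul_of_nonneg_left hs1 (div_nonneg hs.le hrs0.le)
    have h3 : r / (r + s) * 1 + s / (r + s) * 1 = 1 := by field_simp
    linarith
  rw [Ell.norm_def M x, Ell.norm_def M y]
  linarith

theorem Ell.norm_zero' : ‖(0 : M.Ell)‖ = 0 := by
  refine le_antisymm (le_of_forall_pos_le_add fun ε hε => ?_) (Ell.norm_nonneg' M 0)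
  rw [zero_add]
  refine csInf_le (M.admissible_bddBelow _) ⟨hε, ?_, ?_⟩
  · simp [SummableAt, M.map_zero]
  · simp [M.map_zero]

theorem Ell.norm_smul_le' (c : ℝ) (x : M.Ell) : ‖c • x‖ ≤ |c| * ‖x‖ := by
  rcases eq_or_ne c 0 with rfl | hc
  · simp [Ell.norm_zero']
  · have hc' : 0 < |c| := abs_pos.2 hc
    rw [← div_le_iff₀' hc']
    refine le_csInf (Ell.admissible_nonempty M x) fun ρ hρ => ?_
    rw [div_le_iff₀' hc']
    refine csInf_le (M.admissible_bddBelow _) ?_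
    rw [map_smul]
    refine ⟨mul_pos hc' hρ.1, ?_, ?_⟩
    · simpa only [SummableAt, abs_smul_div c ρ hc] using hρ.2.1
    · simpa only [abs_smul_div c ρ hc] using hρ.2.2

theorem Ell.norm_smul' (c : ℝ) (x : M.Ell) : ‖c • x‖ = |c| * ‖x‖ := by
  refine le_antisymm (Ell.norm_smul_le' M c x) ?_
  rcases eq_or_ne c 0 with rfl | hc
  · simp [Ell.norm_zero']
  · have h := Ell.norm_smul_le' M c⁻¹ (c • x)
    rwa [inv_smul_smul₀ hc, abs_inv, ← div_eq_inv_mul, le_div_iff₀' (abs_pos.2 hc)] at h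

theorem Ell.eq_zero_of_norm (x : M.Ell) (hx : ‖x‖ = 0) : x = 0 := by
  refine Ell.seq_injective M ?_
  rw [_root_.map_zero (Ell.seq M)]
  funext n
  by_contra hn
  have hn : 0 < |Ell.seq M x n| := abs_pos.2 hn
  obtain ⟨T, hT⟩ := (M.tendsto_atTop.eventually (eventually_gt_atTop (1 : ℝ))).exists_forall_of_atTop
  have hT1 : (0 : ℝ) < max T 1 := lt_max_of_lt_right one_pos
  have hlt : sInf (M.admissible (Ell.seq M x)) < |Ell.seq M x n| / max T 1 := by
    rw [← Ell.norm_def, hx]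
    exact div_pos hn hT1
  obtain ⟨ρ, ⟨hρ, hs, h1⟩, hlt⟩ := exists_lt_of_csInf_lt (Ell.admissible_nonempty M x) hlt
  have h2 : max T 1 ≤ |Ell.seq M x n| / ρ := by
    rw [lt_div_iff₀ hT1] at hlt
    rw [le_div_iff₀ hρ]
    linarith
  have h3 := hT _ ((le_max_left T 1).trans h2)
  have h4 := hs.le_tsum n fun m _ => term_nonneg hρ _ m
  linarith

theorem Ell.core : NormedSpace.Core ℝ M.Ell where
  norm_nonneg := Ell.norm_nonneg' M
  norm_smul c x := Ell.norm_smul' M c x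
  norm_triangle := Ell.norm_add_le' M
  norm_eq_zero_iff x := ⟨Ell.eq_zero_of_norm M x, fun h => h ▸ Ell.norm_zero' M⟩

noncomputable instance : NormedAddCommGroup M.Ell := NormedAddCommGroup.ofCore (Ell.core M)

noncomputable instance : NormedSpace ℝ M.Ell := NormedSpace.ofCore (Ell.core M)

theorem single_mem (n : ℕ) : Pi.single n (1 : ℝ) ∈ M.ellSubmodule := by
  refine ⟨1, one_pos, summable_of_ne_finset_zero (s := {n}) fun m hm => ?_⟩
  have hm : m ≠ n := by simpa using hm
  simp [Pi.single_eq_of_ne hm, M.map_zero]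

/-- The `n`-th unit vector of `ℓ_M`. -/
def Ell.e (n : ℕ) : M.Ell := ⟨Pi.single n 1, M.single_mem n⟩

/-- `h_M`, the closed linear span of the unit vectors in `ℓ_M`, with the norm of `ℓ_M`. -/
noncomputable def hSpace : Submodule ℝ M.Ell :=
  (Submodule.span ℝ (Set.range (Ell.e M))).topologicalClosure

end OrliczFunction

/-! Write `P A` for the coordinate projections of h_M and choose weights `w n` strictly decreasing
to 1. For each finite `A`, finitely many functionals factoring through `P A` nearly compute `w
A.card * ‖P A x‖`, with an error so small that their maximum still exceeds `w (A.card + 1) * ‖P A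
x‖` when `P A x ≠ 0`. The supremum of |f x| over all these functionals is an equivalent norm. It is
polyhedral once, near each nonzero vector, finitely many functionals attain it: compactness of the
unit sphere of a finite-dimensional subspace then leaves finitely many half-spaces.

Local finiteness (`isIsomorphicallyPolyhedral_of_projections`) needs `‖x‖ < w (A.card + 1) * ‖P A
x‖` for some `A`. The new norm of x then strictly exceeds ‖x‖, so sets of large cardinality,
contributing at most about ‖x‖, do not matter. A small set reaching far out loses to its
intersection with an initial segment, which is smaller and carries a larger weight.

The growth condition supplies the weights (`exists_rate`) and the required `A`
(`exists_norm_lt_mul_norm_hProj`). For ‖x‖ = 1 the modular equals 1. With n large, `A` consists of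
the fewer than n coordinates where M|a_i| > 1/n. Off `A`, M|a_i| is negligible against M(K|a_i|),
whose tail sum is below 1, so `A` carries almost the whole modular. -/

/-! ### Criteria for polyhedrality -/

/-- A space whose norm is, near every nonzero point, the maximum of finitely many functionals of
norm at most one is polyhedral. -/
theorem isPolyhedralSpace_of_locally_finite {X : Type u} [NormedAddCommGroup X] [NormedSpace ℝ X]
    (h : ∀ x : X, x ≠ 0 → ∃ F : Finset (X →L[ℝ] ℝ), (∀ f ∈ F, ‖f‖ ≤ 1) ∧
      ∀ᶠ y in 𝓝 x, ∃ f ∈ F, ‖y‖ ≤ f y) : IsPolyhedralSpace X := by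
  classical
  intro Y hY
  have hne : ∀ y : Y, y ∈ Metric.sphere (0 : Y) 1 → (y : X) ≠ 0 := fun y hy h0 => by
    have h1 : ‖y‖ = 1 := by simpa using hy
    rw [Submodule.coe_norm, h0, norm_zero] at h1
    exact zero_ne_one h1
  choose! F hF1 hF2 using h
  obtain ⟨t, ht, hcov⟩ := (isCompact_sphere (0 : Y) 1).elim_nhds_subcover
    (fun y => {z : Y | ∃ f ∈ F y, ‖(z : X)‖ ≤ f z})
    (fun y hy => continuous_subtype_val.continuousAt.eventually (hF2 y (hne y hy)))
  refine ⟨t.biUnion fun y => (F y).image fun f => (f.comp Y.subtypeL, 1), ?_⟩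
  ext z
  simp only [Metric.mem_closedBall, dist_zero_right, Set.mem_ofPred_eq, Finset.mem_biUnion,
    Finset.mem_image]
  constructor
  · rintro hz _ ⟨y, hy, f, hf, rfl⟩
    have h1 := hF1 y (hne y (ht y hy)) f hf
    calc f z ≤ ‖f z‖ := Real.le_norm_self _
      _ ≤ 1 * ‖(z : X)‖ := f.le_of_opNorm_le h1 _
      _ ≤ 1 := by rw [one_mul]; exact hz
  · intro hz
    rcases eq_or_ne z 0 with rfl | hz0
    · simp
    have hz0' : 0 < ‖z‖ := norm_pos_iff.2 hz0
    have hmem : ‖z‖⁻¹ • z ∈ Metric.sphere (0 : Y) 1 := by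
      rw [mem_sphere_zero_iff_norm, norm_smul, norm_inv, norm_norm, inv_mul_cancel₀ hz0'.ne']
    obtain ⟨y, hy, f, hf, hfz⟩ := by simpa only [Set.mem_iUnion, Set.mem_ofPred_eq] using hcov hmem
    have h2 := hz (f.comp Y.subtypeL, 1) ⟨y, hy, f, hf, rfl⟩
    have h3 : f (z : X) ≤ 1 := h2
    have h4 : ‖((‖z‖⁻¹ • z : Y) : X)‖ = 1 := by simpa using hmem
    rw [h4, Submodule.coe_smul, map_smul, smul_eq_mul, ← div_eq_inv_mul, le_div_iff₀ hz0'] at hfz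
    linarith

/-- A space embedded in a Banach space whose norm is, near every nonzero point of the image, the
maximum of finitely many functionals of norm at most one, is isomorphically polyhedral. -/
theorem isIsomorphicallyPolyhedral_of_embedding {E W : Type u} [NormedAddCommGroup E]
    [NormedSpace ℝ E] [CompleteSpace E] [NormedAddCommGroup W] [NormedSpace ℝ W] [CompleteSpace W]
    (T : E →L[ℝ] W) (hT : AntilipschitzWith 1 T)
    (h : ∀ x : E, x ≠ 0 → ∃ F : Finset (W →L[ℝ] ℝ), (∀ f ∈ F, ‖f‖ ≤ 1) ∧
      ∀ᶠ y in 𝓝 x, ∃ f ∈ F, ‖T y‖ ≤ f (T y)) : IsIsomorphicallyPolyhedral E := by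
  classical
  have hclosed : IsClosed (Set.range T) := hT.isClosed_range T.uniformContinuous
  let e := T.equivRange hT.injective hclosed
  have he : ∀ x, (e x : W) = T x := fun x => rfl
  refine ⟨LinearMap.range (T : E →ₗ[ℝ] W), inferInstance, inferInstance,
    hclosed.completeSpace_coe, ?_, ⟨e⟩⟩
  refine isPolyhedralSpace_of_locally_finite fun y hy => ?_
  obtain ⟨F, hF1, hF⟩ := h (e.symm y) fun h0 => hy (by simpa using h0)
  refine ⟨F.image fun f => f.comp (Submodule.subtypeL _), ?_, ?_⟩
  · intro f hf
    obtain ⟨g, hg, rfl⟩ := Finset.mem_image.1 hf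
    refine ContinuousLinearMap.opNorm_le_bound _ zero_le_one fun z => ?_
    exact g.le_of_opNorm_le (hF1 g hg) _
  · filter_upwards [e.symm.continuous.continuousAt.eventually hF] with z ⟨f, hf, hfz⟩
    rw [← he, e.apply_symm_apply] at hfz
    exact ⟨_, Finset.mem_image_of_mem _ hf, hfz⟩

/-- A Banach space admitting a bounded, norming family of functionals which near every nonzero
point is dominated by a finite subfamily is isomorphically polyhedral. -/
theorem isIsomorphicallyPolyhedral_of_locally_finite {E : Type u} [NormedAddCommGroup E]
    [NormedSpace ℝ E] [CompleteSpace E] (S : Set (E →L[ℝ] ℝ)) (C : ℝ)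
    (hC : ∀ f ∈ S, ‖f‖ ≤ C) (hS : ∀ x : E, x ≠ 0 → ∃ f ∈ S, ‖x‖ ≤ |f x|)
    (h : ∀ x : E, x ≠ 0 → ∃ F : Finset (E →L[ℝ] ℝ), ↑F ⊆ S ∧
      ∀ᶠ y in 𝓝 x, ∃ f ∈ F, ∀ g ∈ S, |g y| ≤ |f y|) : IsIsomorphicallyPolyhedral E := by
  classical
  -- With the discrete topology, bounded continuous functions on `S` form ℓ_∞(S), and the new norm
  -- is the sup norm of the evaluations.
  let _ : TopologicalSpace S := ⊥
  have : DiscreteTopology S := ⟨rfl⟩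
  have hb : ∀ (x : E) (f : S), ‖(f : E →L[ℝ] ℝ) x‖ ≤ C * ‖x‖ := fun x f =>
    f.1.le_of_opNorm_le (hC f f.2) x
  let T₀ : E →ₗ[ℝ] BoundedContinuousFunction S ℝ :=
    { toFun := fun x => BoundedContinuousFunction.ofNormedAddCommGroup
        (fun f : S => (f : E →L[ℝ] ℝ) x) continuous_of_discreteTopology _ (hb x)
      map_add' := fun x y => by ext f; simp
      map_smul' := fun c x => by ext f; simp }
  -- `C` may be negative when `S` is empty, hence `max C 0`.
  let T : E →L[ℝ] BoundedContinuousFunction S ℝ := T₀.mkContinuous (max C 0) fun x =>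
    (BoundedContinuousFunction.norm_le (by positivity)).2 fun f => (hb x f).trans
      (mul_le_mul_of_nonneg_right (le_max_left _ _) (norm_nonneg x))
  have hlow : ∀ x, ‖x‖ ≤ ‖T x‖ := fun x => by
    rcases eq_or_ne x 0 with rfl | hx
    · simp
    obtain ⟨f, hf, hfx⟩ := hS x hx
    exact hfx.trans ((T x).norm_coe_le_norm ⟨f, hf⟩)
  have hanti : AntilipschitzWith 1 T := T.antilipschitz_of_bound fun x => by simpa using hlow x
  refine isIsomorphicallyPolyhedral_of_embedding T hanti fun x hx => ?_
  obtain ⟨F, hFS, hF⟩ := h x hx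
  let ev : S → (BoundedContinuousFunction S ℝ →L[ℝ] ℝ) := fun f =>
    BoundedContinuousFunction.evalCLM ℝ f
  have hev : ∀ f y, ev f (T y) = (f : E →L[ℝ] ℝ) y := fun f y => rfl
  have hev1 : ∀ f, ‖ev f‖ ≤ 1 := fun f =>
    (ev f).opNorm_le_bound zero_le_one fun y => by
      rw [one_mul]; exact y.norm_coe_le_norm f
  refine ⟨(F.subtype (· ∈ S)).image ev ∪ (F.subtype (· ∈ S)).image fun f => -ev f, ?_, ?_⟩
  · intro f hf
    simp only [Finset.mem_union, Finset.mem_image] at hf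
    rcases hf with ⟨g, -, rfl⟩ | ⟨g, -, rfl⟩
    · exact hev1 g
    · rw [norm_neg]; exact hev1 g
  · filter_upwards [hF] with z ⟨f, hf, hfz⟩
    have hle : ‖T z‖ ≤ |f z| :=
      (BoundedContinuousFunction.norm_le (abs_nonneg _)).2 fun g => hfz g g.2
    have hmem : (⟨f, hFS hf⟩ : S) ∈ F.subtype (· ∈ S) := Finset.mem_subtype.2 hf
    rcases abs_choice (f z) with h1 | h1
    · exact ⟨_, Finset.mem_union_left _ (Finset.mem_image_of_mem _ hmem), by
        rw [hev, ← h1]; exact hle⟩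
    · exact ⟨_, Finset.mem_union_right _ (Finset.mem_image_of_mem _ hmem), by
        rw [_root_.neg_apply, hev, ← h1]; exact hle⟩

/-! ### Renorming through coordinate projections -/

/-- A norm on a finite-dimensional space is approximated by the maximum of finitely many
functionals. -/
theorem exists_finset_functionals_approx {V : Type*} [NormedAddCommGroup V] [NormedSpace ℝ V]
    [FiniteDimensional ℝ V] {a b : ℝ} (ha : 0 < a) (hab : b < a) :
    ∃ F : Finset (V →L[ℝ] ℝ), (∀ f ∈ F, ‖f‖ ≤ a) ∧ ∀ v, ∃ f ∈ F, b * ‖v‖ ≤ |f v| := by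
  classical
  have key : ∀ v : V, ∃ f : V →L[ℝ] ℝ, ‖f‖ ≤ 1 ∧ f v = ‖v‖ := fun v => by
    obtain ⟨f, hf, hv⟩ := exists_dual_vector'' ℝ v
    exact ⟨f, hf, hv⟩
  choose g hg1 hg2 using key
  have hcont : ∀ v : V, Continuous fun u => g v u := fun v => (g v).continuous
  obtain ⟨t, ht, hcov⟩ := (isCompact_sphere (0 : V) 1).elim_nhds_subcover
    (fun v => {u : V | b < a * g v u}) (fun v hv => by
      have h1 : ‖v‖ = 1 := by simpa using hv
      refine (((hcont v).const_mul a).continuousAt (x := v)).eventually (lt_mem_nhds ?_)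
      simpa only [hg2, h1, mul_one] using hab)
  -- The functional 0 serves `v = 0`: in the trivial space the sphere is empty and `t` provides
  -- nothing.
  refine ⟨insert 0 (t.image fun v => a • g v), ?_, fun v => ?_⟩
  · intro f hf
    rcases Finset.mem_insert.1 hf with rfl | hf
    · simpa using ha.le
    obtain ⟨v, -, rfl⟩ := Finset.mem_image.1 hf
    rw [norm_smul, Real.norm_of_nonneg ha.le]
    exact mul_le_of_le_one_right ha.le (hg1 v)
  · rcases eq_or_ne v 0 with rfl | hv
    · exact ⟨0, Finset.mem_insert_self _ _, by simp⟩
    have hv0 : 0 < ‖v‖ := norm_pos_iff.2 hv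
    have hmem : ‖v‖⁻¹ • v ∈ Metric.sphere (0 : V) 1 := by
      simp [norm_smul, inv_mul_cancel₀ hv0.ne']
    obtain ⟨u, hu, hlt⟩ := by simpa only [Set.mem_iUnion, Set.mem_ofPred_eq] using hcov hmem
    refine ⟨_, Finset.mem_insert_of_mem (Finset.mem_image_of_mem _ hu), ?_⟩
    rw [map_smul, smul_eq_mul, ← div_eq_inv_mul, ← mul_div_assoc, lt_div_iff₀ hv0] at hlt
    exact hlt.le.trans (le_abs_self _)

/-- A Banach space with contractive finite-rank coordinate projections `P A` converging to the
identity, in which every nonzero vector is nearly normed by some `P A` at a rate `w` depending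
only on the cardinality of `A`, is isomorphically polyhedral. -/
theorem isIsomorphicallyPolyhedral_of_projections {E : Type u} [NormedAddCommGroup E]
    [NormedSpace ℝ E] [CompleteSpace E] (P : Finset ℕ → E →L[ℝ] E)
    (hfin : ∀ A, FiniteDimensional ℝ (LinearMap.range (P A : E →ₗ[ℝ] E)))
    (hnorm : ∀ A x, ‖P A x‖ ≤ ‖x‖) (hinter : ∀ A B x, P A (P B x) = P (A ∩ B) x)
    (hlim : ∀ x, Tendsto (fun m => P (Finset.range m) x) atTop (𝓝 x))
    (w : ℕ → ℝ) (hw : StrictAnti w) (hw1 : Tendsto w atTop (𝓝 1))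
    (h : ∀ x, x ≠ 0 → ∃ A : Finset ℕ, ‖x‖ < w (A.card + 1) * ‖P A x‖) :
    IsIsomorphicallyPolyhedral E := by
  classical
  have hwpos : ∀ n, 1 < w n := fun n =>
    (hw.antitone.le_of_tendsto hw1 (n + 1)).trans_lt (hw n.lt_succ_self)
  let b : ℕ → ℝ := fun n => (w n + w (n + 1)) / 2
  have hbw : ∀ n, b n < w n := fun n => by
    have := hw n.lt_succ_self; simp only [b]; linarith
  have hwb : ∀ n, w (n + 1) < b n := fun n => by
    have := hw n.lt_succ_self; simp only [b]; linarith
  have hb0 : ∀ n, 0 < b n := fun n => by linarith [hwb n, hwpos (n + 1)]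
  have key : ∀ A : Finset ℕ, ∃ F : Finset (E →L[ℝ] ℝ),
      (∀ f ∈ F, ∀ x, |f x| ≤ w A.card * ‖P A x‖) ∧
      ∀ x, ∃ f ∈ F, b A.card * ‖P A x‖ ≤ |f x| := fun A => by
    have := hfin A
    obtain ⟨F, hF1, hF2⟩ := exists_finset_functionals_approx (V := LinearMap.range (P A : E →ₗ[ℝ] E))
      (zero_lt_one.trans (hwpos A.card)) (hbw A.card)
    refine ⟨F.image fun f => f.comp (P A).rangeRestrict, ?_, fun x => ?_⟩
    · intro f hf x
      obtain ⟨g, hg, rfl⟩ := Finset.mem_image.1 hf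
      exact g.le_of_opNorm_le (hF1 g hg) _
    · obtain ⟨f, hf, hfx⟩ := hF2 ((P A).rangeRestrict x)
      exact ⟨_, Finset.mem_image_of_mem _ hf, hfx⟩
  choose N hN1 hN2 using key
  -- The shift by one in `h` is what makes this work: `w (A.card + 1)` lies below the accuracy `b
  -- A.card` of `N A`.
  have hlarge : ∀ x, x ≠ 0 → ∃ A, ∃ f ∈ N A, ‖x‖ < |f x| := fun x hx => by
    obtain ⟨A, hA⟩ := h x hx
    obtain ⟨f, hf, hfx⟩ := hN2 A x
    exact ⟨A, f, hf, hA.trans_le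
      ((mul_le_mul_of_nonneg_right (hwb A.card).le (norm_nonneg _)).trans hfx)⟩
  refine isIsomorphicallyPolyhedral_of_locally_finite (⋃ A, (N A : Set (E →L[ℝ] ℝ))) (w 0)
    ?_ ?_ ?_
  · intro f hf
    obtain ⟨A, hf⟩ := Set.mem_iUnion.1 hf
    refine f.opNorm_le_bound (zero_lt_one.trans (hwpos 0)).le fun x => (hN1 A f hf x).trans ?_
    exact mul_le_mul (hw.antitone (Nat.zero_le _)) (hnorm A x) (norm_nonneg _)
      (zero_lt_one.trans (hwpos 0)).le
  · intro x hx
    obtain ⟨A, f, hf, hfx⟩ := hlarge x hx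
    exact ⟨f, Set.mem_iUnion.2 ⟨A, hf⟩, hfx.le⟩
  · intro x hx
    obtain ⟨A₀, f₀, hf₀, hfx₀⟩ := hlarge x hx
    -- From cardinality `n₀` on, every functional is beaten by `f₀` alone, and this persists near
    -- `x`.
    obtain ⟨n₀, hn₀⟩ : ∃ n, w n * ‖x‖ < |f₀ x| := by
      have h1 : Tendsto (fun n => w n * ‖x‖) atTop (𝓝 (1 * ‖x‖)) := hw1.mul_const _
      rw [one_mul] at h1
      exact (h1.eventually (gt_mem_nhds hfx₀)).exists
    have hf₀pos : 0 < |f₀ x| := (norm_nonneg x).trans_lt hfx₀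
    have hr : ∀ k, 0 < 1 - w (k + 1) / b k := fun k => by
      rw [sub_pos, div_lt_one (hb0 k)]; exact hwb k
    -- The tail of `x` beyond `m` must be smaller than the relative gap between `w (k + 1)` and `b
    -- k`, for the finitely many cardinalities `k < n₀`.
    obtain ⟨m, hm, hmA⟩ : ∃ m, (∀ k ∈ Finset.range n₀,
        w 0 * ‖x - P (Finset.range m) x‖ < (1 - w (k + 1) / b k) * |f₀ x|) ∧
        A₀ ⊆ Finset.range m := by
      have h1 : Tendsto (fun m => w 0 * ‖x - P (Finset.range m) x‖) atTop (𝓝 0) := by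
        simpa using ((tendsto_const_nhds (x := x)).sub (hlim x)).norm.const_mul (w 0)
      refine (((Filter.eventually_all_finset (Finset.range n₀)).2 fun k _ =>
        h1.eventually (gt_mem_nhds (mul_pos (hr k) hf₀pos))).and
        (Filter.eventually_atTop.2 ⟨A₀.sup id + 1, fun m hm i hi => ?_⟩)).exists
      exact Finset.mem_range.2 ((Finset.le_sup (f := id) hi).trans_lt hm)
    refine ⟨(Finset.range m).powerset.biUnion N, ?_, ?_⟩
    · intro f hf
      obtain ⟨A, -, hf⟩ := Finset.mem_biUnion.1 (Finset.mem_coe.1 hf)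
      exact Set.mem_iUnion.2 ⟨A, hf⟩
    have hc0 : Continuous fun y => |f₀ y| := f₀.continuous.abs
    have e1 : ∀ᶠ y in 𝓝 x, w n₀ * ‖y‖ < |f₀ y| :=
      (continuous_const.mul continuous_norm).continuousAt.eventually_lt hc0.continuousAt hn₀
    have e2 : ∀ᶠ y in 𝓝 x, ∀ k ∈ Finset.range n₀,
        w 0 * ‖y - P (Finset.range m) y‖ < (1 - w (k + 1) / b k) * |f₀ y| :=
      (Filter.eventually_all_finset _).2 fun k hk =>
        (continuous_const.mul
          (continuous_id.sub (P (Finset.range m)).continuous).norm).continuousAt.eventually_lt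
          (continuous_const.mul hc0).continuousAt (hm k hk)
    filter_upwards [e1, e2] with y hy1 hy2
    have hf₀mem : f₀ ∈ (Finset.range m).powerset.biUnion N :=
      Finset.mem_biUnion.2 ⟨A₀, Finset.mem_powerset.2 hmA, hf₀⟩
    obtain ⟨f, hf, hfmax⟩ := Finset.exists_max_image _ (fun f : E →L[ℝ] ℝ => |f y|) ⟨f₀, hf₀mem⟩
    refine ⟨f, hf, fun g hg => ?_⟩
    obtain ⟨A, hg⟩ := Set.mem_iUnion.1 hg
    by_cases hA : A ⊆ Finset.range m
    · exact hfmax g (Finset.mem_biUnion.2 ⟨A, Finset.mem_powerset.2 hA, hg⟩)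
    have hgy := hN1 A g hg y
    rcases le_or_gt n₀ A.card with hcard | hcard
    · calc |g y| ≤ w A.card * ‖P A y‖ := hgy
        _ ≤ w n₀ * ‖y‖ := mul_le_mul (hw.antitone hcard) (hnorm A y) (norm_nonneg _)
          (zero_lt_one.trans (hwpos _)).le
        _ ≤ |f₀ y| := hy1.le
        _ ≤ |f y| := hfmax f₀ hf₀mem
    -- Cutting `A` down to `B` costs only the small tail and loses at least one element, so `w
    -- A.card ≤ w (B.card + 1) < b B.card`; the gap absorbs the tail.
    · set B := A ∩ Finset.range m with hB
      have hBA : B.card < A.card := Finset.card_lt_card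
        ⟨Finset.inter_subset_left, fun hsub => hA (hsub.trans Finset.inter_subset_right)⟩
      have hPB : b B.card * ‖P B y‖ ≤ |f y| := by
        obtain ⟨f₁, hf₁, hf₁y⟩ := hN2 B y
        exact hf₁y.trans (hfmax f₁ (Finset.mem_biUnion.2
          ⟨B, Finset.mem_powerset.2 Finset.inter_subset_right, hf₁⟩))
      have hsplit : ‖P A y‖ ≤ ‖P B y‖ + ‖y - P (Finset.range m) y‖ := by
        have e : P A y = P B y + P A (y - P (Finset.range m) y) := by
          rw [map_sub, hinter]; abel
        rw [e]
        exact (norm_add_le _ _).trans (add_le_add_right (hnorm _ _) _)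
      have hk := hy2 B.card (Finset.mem_range.2 (hBA.trans hcard))
      have hq : w (B.card + 1) * ‖P B y‖ ≤ w (B.card + 1) / b B.card * |f y| := by
        rw [div_mul_eq_mul_div, le_div_iff₀ (hb0 _), mul_assoc, mul_comm ‖_‖]
        exact mul_le_mul_of_nonneg_left hPB (zero_lt_one.trans (hwpos _)).le
      have hwA : w A.card ≤ w (B.card + 1) := hw.antitone hBA
      have hwA0 : w A.card ≤ w 0 := hw.antitone (Nat.zero_le _)
      have h0 := mul_le_mul_of_nonneg_left (hfmax f₀ hf₀mem) (hr B.card).le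
      calc |g y| ≤ w A.card * ‖P A y‖ := hgy
        _ ≤ w A.card * (‖P B y‖ + ‖y - P (Finset.range m) y‖) :=
          mul_le_mul_of_nonneg_left hsplit (zero_lt_one.trans (hwpos _)).le
        _ ≤ w (B.card + 1) * ‖P B y‖ + w 0 * ‖y - P (Finset.range m) y‖ := by
          rw [mul_add]
          exact add_le_add (mul_le_mul_of_nonneg_right hwA (norm_nonneg _))
            (mul_le_mul_of_nonneg_right hwA0 (norm_nonneg _))
        _ ≤ |f y| := by linarith

namespace OrliczFunction

variable (M : OrliczFunction)

/-! ### Weights from the growth condition -/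

/-- A quantitative form of `M (K t) / M t → ∞`: there is a rate `w` decreasing to `1`. -/
theorem exists_rate (hM : M.NonDegenerate) {K : ℝ} (hK0 : 0 < K)
    (hK : Tendsto (fun t : ℝ => M (K * t) / M t) (𝓝[>] 0) atTop) :
    ∃ w : ℕ → ℝ, StrictAnti w ∧ Tendsto w atTop (𝓝 1) ∧
      ∀ᶠ n : ℕ in atTop, ∀ s : ℝ, 0 ≤ s → n * M s ≤ 1 → w n * M s ≤ (w n - 1) * M (K * s) := by
  -- Capping at 1 keeps the set bounded, so that `sSup` is a genuine supremum; at `s = 0` the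
  -- quotient is 0 / 0 = 0.
  let S : ℕ → Set ℝ := fun n => (fun s => min 1 (M s / M (K * s))) '' {s | 0 ≤ s ∧ n * M s ≤ 1}
  have hbdd : ∀ n, BddAbove (S n) := fun n =>
    ⟨1, by rintro _ ⟨s, -, rfl⟩; exact min_le_left _ _⟩
  have hzero : ∀ n, (0 : ℝ) ∈ S n := fun n => ⟨0, by simp [M.map_zero], by simp [M.map_zero]⟩
  let d : ℕ → ℝ := fun n => sSup (S n)
  have hd0 : ∀ n, 0 ≤ d n := fun n => le_csSup (hbdd n) (hzero n)
  have hdanti : Antitone d := fun m n hmn => csSup_le_csSup (hbdd m) ⟨0, hzero n⟩ (by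
    rintro _ ⟨s, ⟨hs, hns⟩, rfl⟩
    refine ⟨s, ⟨hs, le_trans ?_ hns⟩, rfl⟩
    exact mul_le_mul_of_nonneg_right (by exact_mod_cast hmn) (M.nonneg hs))
  have hdlim : Tendsto d atTop (𝓝 0) := by
    refine tendsto_order.2 ⟨fun a ha => Eventually.of_forall fun n => ha.trans_le (hd0 n),
      fun a ha => ?_⟩
    have h1 := hK.eventually (eventually_ge_atTop (2 / a))
    obtain ⟨t, ht, htK⟩ := mem_nhdsGT_iff_exists_Ioo_subset.1 h1
    have ht : 0 < t := ht
    -- For such `n`, `n * M s ≤ 1` forces `s < t`, where the growth bound applies.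
    filter_upwards [eventually_gt_atTop ⌈1 / M t⌉₊] with n hn
    have hn : 1 < n * M t := by
      rw [← div_lt_iff₀ (hM t ht)]; exact Nat.lt_of_ceil_lt hn
    refine (csSup_le ⟨0, hzero n⟩ ?_).trans_lt (half_lt_self ha)
    rintro _ ⟨s, ⟨hs, hns⟩, rfl⟩
    rcases hs.eq_or_lt with rfl | hs
    · simpa [M.map_zero] using (half_pos ha).le
    have hst : s < t := by
      by_contra! hts
      have := mul_le_mul_of_nonneg_left (M.mono ht.le hts) (Nat.cast_nonneg (α := ℝ) n)
      linarith
    have h2 : 2 / a ≤ M (K * s) / M s := htK ⟨hs, hst⟩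
    refine (min_le_right _ _).trans ?_
    have h3 := inv_anti₀ (by positivity) h2
    rwa [inv_div, inv_div] at h3
  -- The summand 1 / (n + 1) makes the sequence strictly decreasing. The factor 2 gives `w n * d n ≤
  -- w n - 1` as soon as `d n ≤ 1 / 2`.
  refine ⟨fun n => 1 + 2 * d n + 1 / ((n : ℝ) + 1), ?_, ?_, ?_⟩
  · refine strictAnti_nat_of_succ_lt fun n => ?_
    have h1 := hdanti n.le_succ
    have h2 : 1 / (((n + 1 : ℕ) : ℝ) + 1) < 1 / ((n : ℝ) + 1) :=
      one_div_lt_one_div_of_lt (by positivity) (by push_cast; linarith)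
    have h3 : d (n + 1) ≤ d n := h1
    linarith
  · have := (tendsto_const_nhds (x := (1 : ℝ))).add (hdlim.const_mul 2) |>.add
      (tendsto_one_div_add_atTop_nhds_zero_nat (𝕜 := ℝ))
    simpa using this
  · filter_upwards [hdlim.eventually (gt_mem_nhds (show (0 : ℝ) < 1 / 2 by norm_num))] with n hn s
      hs hns
    rcases hs.eq_or_lt with rfl | hs
    · simp [M.map_zero]
    have hKs : 0 < M (K * s) := hM _ (mul_pos hK0 hs)
    have h1 : min 1 (M s / M (K * s)) ≤ d n := le_csSup (hbdd n) ⟨s, ⟨hs.le, hns⟩, rfl⟩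
    have h2 : M s ≤ d n * M (K * s) := by
      rw [← div_le_iff₀ hKs]
      rcases min_le_iff.1 h1 with h | h
      · linarith
      · exact h
    set r : ℝ := 1 / ((n : ℝ) + 1)
    have hr : 0 < r := by positivity
    have hw : 0 ≤ 1 + 2 * d n + r := by linarith [hd0 n]
    refine (mul_le_mul_of_nonneg_left h2 hw).trans ?_
    rw [← mul_assoc]
    refine mul_le_mul_of_nonneg_right ?_ hKs.le
    nlinarith [hd0 n]

/-! ## Norm and modular -/

variable {M}

theorem Ell.norm_le_of_tsum_le {x : M.Ell} {ρ : ℝ} (hρ : 0 < ρ)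
    (hs : M.SummableAt ρ (Ell.seq M x)) (h : ∑' n, M (|Ell.seq M x n| / ρ) ≤ 1) : ‖x‖ ≤ ρ :=
  csInf_le (M.admissible_bddBelow _) ⟨hρ, hs, h⟩

theorem Ell.of_norm_lt {x : M.Ell} {ρ : ℝ} (h : ‖x‖ < ρ) :
    M.SummableAt ρ (Ell.seq M x) ∧ ∑' n, M (|Ell.seq M x n| / ρ) ≤ 1 := by
  obtain ⟨r, ⟨hr, hs, h1⟩, hlt⟩ := exists_lt_of_csInf_lt (Ell.admissible_nonempty M x) h
  have hρ : 0 < ρ := hr.trans hlt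
  have hle : ∀ n, M (|Ell.seq M x n| / ρ) ≤ M (|Ell.seq M x n| / r) := fun n =>
    M.mono (by positivity) (div_le_div_of_nonneg_left (abs_nonneg _) hr hlt.le)
  have hs' : M.SummableAt ρ (Ell.seq M x) := Summable.of_nonneg_of_le (term_nonneg hρ _) hle hs
  exact ⟨hs', (hs'.tsum_le_tsum hle hs).trans h1⟩

theorem Ell.sum_le_one {x : M.Ell} {ρ : ℝ} (h : ‖x‖ < ρ) (A : Finset ℕ) :
    ∑ n ∈ A, M (|Ell.seq M x n| / ρ) ≤ 1 :=
  ((Ell.of_norm_lt h).1.sum_le_tsum A fun n _ =>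
    term_nonneg ((norm_nonneg x).trans_lt h) _ n).trans (Ell.of_norm_lt h).2

/-- Since the terms are nonnegative, bounded finite sums already give summability. Limits can
therefore be taken in finite sums, as in the completeness proof. -/
theorem Ell.norm_le_of_sum_le {x : M.Ell} {ρ : ℝ} (hρ : 0 < ρ)
    (h : ∀ A : Finset ℕ, ∑ n ∈ A, M (|Ell.seq M x n| / ρ) ≤ 1) : ‖x‖ ≤ ρ := by
  have hs : M.SummableAt ρ (Ell.seq M x) := summable_of_sum_le (term_nonneg hρ _) h
  exact Ell.norm_le_of_tsum_le hρ hs (hs.tsum_le_of_sum_le h)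

theorem Ell.norm_le_norm {x y : M.Ell} (h : ∀ n, |Ell.seq M x n| ≤ |Ell.seq M y n|) :
    ‖x‖ ≤ ‖y‖ := by
  refine le_of_forall_gt_imp_ge_of_dense fun ρ hρ => ?_
  have hρ0 : 0 < ρ := (norm_nonneg y).trans_lt hρ
  refine Ell.norm_le_of_sum_le hρ0 fun A => le_trans (Finset.sum_le_sum fun n _ => ?_)
    (Ell.sum_le_one hρ A)
  exact M.mono (by positivity) (div_le_div_of_nonneg_right (h n) hρ0.le)

-- M exceeds 1 from some point on, so a single coordinate that is too large would already push the
-- modular above 1. This makes the coordinate functionals continuous.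
variable (M) in
theorem Ell.exists_abs_seq_le : ∃ T : ℝ, ∀ (x : M.Ell) (n : ℕ), |Ell.seq M x n| ≤ T * ‖x‖ := by
  obtain ⟨T, hT⟩ := (M.tendsto_atTop.eventually (eventually_gt_atTop (1 : ℝ))).exists_forall_of_atTop
  refine ⟨max T 1, fun x n => ?_⟩
  have hT1 : (0 : ℝ) < max T 1 := lt_max_of_lt_right one_pos
  rw [← div_le_iff₀' hT1]
  refine le_of_forall_gt_imp_ge_of_dense fun ρ hρ => ?_
  have hρ0 : 0 < ρ := (norm_nonneg x).trans_lt hρ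
  have h1 := Ell.sum_le_one hρ {n}
  rw [Finset.sum_singleton] at h1
  rw [div_le_iff₀' hT1, ← div_le_iff₀ hρ0]
  by_contra! hlt
  linarith [hT _ ((le_max_left T 1).trans hlt.le)]

theorem tendsto_term {ι : Type*} {l : Filter ι} {u : ι → ℝ} {t ρ : ℝ} (hρ : 0 < ρ)
    (h : Tendsto u l (𝓝 t)) : Tendsto (fun i => M (|u i| / ρ)) l (𝓝 (M (|t| / ρ))) := by
  have h1 : ContinuousWithinAt M (Set.Ici 0) (|t| / ρ) :=
    M.continuousOn _ (Set.mem_Ici.2 (by positivity))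
  refine h1.tendsto.comp (tendsto_nhdsWithin_iff.2 ⟨h.abs.div_const ρ, ?_⟩)
  exact Eventually.of_forall fun i => Set.mem_Ici.2 (by positivity)

/-! ### Completeness -/

instance : CompleteSpace M.Ell := by
  refine Metric.complete_of_cauchySeq_tendsto fun u hu => ?_
  obtain ⟨T, hT⟩ := Ell.exists_abs_seq_le M
  have hcoord : ∀ n, ∃ a, Tendsto (fun k => Ell.seq M (u k) n) atTop (𝓝 a) := fun n => by
    let φ : M.Ell →L[ℝ] ℝ := ((LinearMap.proj n).comp (Ell.seq M)).mkContinuous T fun x => hT x n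
    exact cauchySeq_tendsto_of_complete (hu.map φ.uniformContinuous)
  choose a ha using hcoord
  -- The Cauchy bound on finite modular sums passes to the coordinatewise limit by continuity of M.
  have key : ∀ ε > 0, ∃ N, ∀ k ≥ N, ∀ A : Finset ℕ,
      ∑ n ∈ A, M (|Ell.seq M (u k) n - a n| / ε) ≤ 1 := fun ε hε => by
    obtain ⟨N, hN⟩ := Metric.cauchySeq_iff.1 hu ε hε
    refine ⟨N, fun k hk A => ?_⟩
    refine le_of_tendsto (tendsto_finsetSum A fun n _ =>
      tendsto_term (M := M) hε ((tendsto_const_nhds (x := Ell.seq M (u k) n)).sub (ha n))) ?_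
    filter_upwards [eventually_ge_atTop N] with l hl
    have h1 : ‖u k - u l‖ < ε := by rw [← dist_eq_norm]; exact hN k hk l hl
    have h2 := Ell.sum_le_one h1 A
    rw [map_sub] at h2
    exact h2
  have hmem : a ∈ M.ellSubmodule := by
    obtain ⟨N, hN⟩ := key 1 one_pos
    have h1 : Ell.seq M (u N) - a ∈ M.ellSubmodule :=
      ⟨1, one_pos, summable_of_sum_le (term_nonneg one_pos _) (hN N le_rfl)⟩
    have h2 := M.ellSubmodule.sub_mem (u N).2 h1
    have e : (u N).1 - (Ell.seq M (u N) - a) = a := sub_sub_cancel _ _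
    rwa [e] at h2
  let x : M.Ell := ⟨a, hmem⟩
  have hx : Ell.seq M x = a := rfl
  refine ⟨x, Metric.tendsto_atTop.2 fun ε hε => ?_⟩
  obtain ⟨N, hN⟩ := key (ε / 2) (half_pos hε)
  refine ⟨N, fun k hk => ?_⟩
  rw [dist_eq_norm]
  refine (Ell.norm_le_of_sum_le (half_pos hε) fun A => ?_).trans_lt (half_lt_self hε)
  rw [map_sub, hx]
  exact hN k hk A

instance : CompleteSpace M.hSpace :=
  (Submodule.isClosed_topologicalClosure _).completeSpace_coe

/-! ### The modular on the closed span -/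

theorem Ell.seq_e (i : ℕ) : Ell.seq M (Ell.e M i) = Pi.single i 1 := rfl

theorem exists_seq_eq_zero_of_mem_span {z : M.Ell}
    (hz : z ∈ Submodule.span ℝ (Set.range (Ell.e M))) : ∃ m, ∀ n ≥ m, Ell.seq M z n = 0 := by
  induction hz using Submodule.span_induction with
  | mem z hz =>
    obtain ⟨i, rfl⟩ := hz
    refine ⟨i + 1, fun n hn => ?_⟩
    rw [Ell.seq_e, Pi.single_eq_of_ne (by omega)]
  | zero => exact ⟨0, fun n _ => by simp⟩
  | add x y _ _ hx hy =>
    obtain ⟨m, hm⟩ := hx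
    obtain ⟨m', hm'⟩ := hy
    refine ⟨max m m', fun n hn => ?_⟩
    rw [map_add, Pi.add_apply, hm n (le_of_max_le_left hn), hm' n (le_of_max_le_right hn), add_zero]
  | smul c x _ hx =>
    obtain ⟨m, hm⟩ := hx
    exact ⟨m, fun n hn => by rw [map_smul, Pi.smul_apply, hm n hn, smul_zero]⟩

theorem exists_finite_approx (x : M.hSpace) {ε : ℝ} (hε : 0 < ε) :
    ∃ z : M.Ell, (∃ m, ∀ n ≥ m, Ell.seq M z n = 0) ∧ ‖(x : M.Ell) - z‖ < ε := by
  obtain ⟨z, hz, hd⟩ := Metric.mem_closure_iff.1 x.2 ε hε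
  exact ⟨z, exists_seq_eq_zero_of_mem_span hz, by rwa [← dist_eq_norm]⟩

/-- The modular of an element of `h_M` is finite at every scale. -/
theorem summableAt_of_mem_hSpace (x : M.hSpace) {ρ : ℝ} (hρ : 0 < ρ) :
    M.SummableAt ρ (Ell.seq M x) := by
  -- Beyond the support of `z`, `x` coincides with `x - z`, whose norm is below `ρ`.
  obtain ⟨z, ⟨m, hm⟩, hz⟩ := exists_finite_approx x hρ
  have h1 := (Ell.of_norm_lt hz).1
  refine (summable_nat_add_iff m).1 (((summable_nat_add_iff m).2 h1).congr fun n => ?_)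
  rw [map_sub, Pi.sub_apply, hm _ (Nat.le_add_left m n), sub_zero]

/-- The modular is `1` on the unit sphere of `h_M`. -/
theorem tsum_eq_one (x : M.hSpace) (hx : ‖x‖ = 1) : ∑' n, M |Ell.seq M x n| = 1 := by
  set a := Ell.seq M (x : M.Ell) with ha
  have hx' : ‖(x : M.Ell)‖ = 1 := hx
  have hs : ∀ c : ℝ, 0 < c → Summable fun n => M (c * |a n|) := fun c hc =>
    (summableAt_of_mem_hSpace x (inv_pos.2 hc)).congr fun n => by rw [div_inv_eq_mul, mul_comm]
  have hs1 : Summable fun n => M |a n| := by simpa using hs 1 one_pos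
  -- The function c ↦ ∑ M(c|a_n|) is finite and convex on (0, ∞); comparing its values near 1 with
  -- those at 1 and 2 replaces a continuity argument.
  have hconv : ∀ {s c d : ℝ}, 0 ≤ s → s ≤ 1 → 0 < c → 0 < d →
      ∑' n, M (((1 - s) * c + s * d) * |a n|) ≤
        (1 - s) * ∑' n, M (c * |a n|) + s * ∑' n, M (d * |a n|) := fun {s c d} hs0 hs1 hc hd => by
    rw [← tsum_mul_left, ← tsum_mul_left,
      ← ((hs c hc).mul_left _).tsum_add ((hs d hd).mul_left _)]
    refine (hs _ ?_).tsum_le_tsum (fun n => ?_) (((hs c hc).mul_left _).add ((hs d hd).mul_left _))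
    · rcases hs0.eq_or_lt with rfl | h
      · simpa using hc
      · have := mul_pos h hd
        have := mul_nonneg (sub_nonneg.2 hs1) hc.le
        linarith
    · have h := M.convexOn.2 (Set.mem_Ici.2 (mul_nonneg hc.le (abs_nonneg (a n))))
        (Set.mem_Ici.2 (mul_nonneg hd.le (abs_nonneg (a n)))) (sub_nonneg.2 hs1) hs0 (by ring)
      simp only [smul_eq_mul] at h
      convert h using 2
      ring
  have hlim : ∀ p q : ℝ, Tendsto (fun s : ℝ => (1 - s) * p + s * q) (𝓝[>] 0) (𝓝 p) :=
    fun p q => by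
      have : Continuous fun s : ℝ => (1 - s) * p + s * q := by fun_prop
      simpa using (this.tendsto 0).mono_left nhdsWithin_le_nhds
  have hsmall : ∀ᶠ s : ℝ in 𝓝[>] 0, 0 < s ∧ s < 1 / 2 :=
    mem_nhdsGT_iff_exists_Ioo_subset.2 ⟨1 / 2, by norm_num, fun s hs => hs⟩
  refine le_antisymm (ge_of_tendsto (hlim 1 (∑' n, M (2 * |a n|))) ?_)
    (ge_of_tendsto (hlim (∑' n, M |a n|) (∑' n, M (2 * |a n|))) ?_)
  -- Here 1 is a convex combination of 2 and a scale below 1, at which the modular is at most 1.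
  · filter_upwards [hsmall] with s hs'
    have hs2 : 0 < 1 - s := by linarith
    have hc : 0 < (1 - 2 * s) / (1 - s) := div_pos (by linarith) hs2
    have h := hconv hs'.1.le (by linarith) hc two_pos
    have e : (1 - s) * ((1 - 2 * s) / (1 - s)) + s * 2 = 1 := by
      rw [mul_div_cancel₀ _ hs2.ne']; ring
    simp only [e, one_mul] at h
    refine h.trans (add_le_add_left (mul_le_mul_of_nonneg_left ?_ hs2.le) _)
    have hlt : ‖(x : M.Ell)‖ < (1 - s) / (1 - 2 * s) := by
      rw [hx', lt_div_iff₀ (by linarith)]; linarith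
    have h2 := (Ell.of_norm_lt hlt).2
    refine le_of_eq_of_le (tsum_congr fun n => ?_) h2
    rw [← ha, div_eq_mul_inv |a n|, inv_div, mul_comm]
  -- At scale 1 + s the modular is at least 1, since otherwise ‖x‖ ≤ 1 / (1 + s).
  · filter_upwards [hsmall] with s hs'
    have h := hconv hs'.1.le (by linarith) one_pos two_pos
    simp only [one_mul] at h
    refine le_trans ?_ h
    by_contra! hlt
    have hc : 0 < (1 - s) * 1 + s * 2 := by linarith
    have h3 : ‖(x : M.Ell)‖ ≤ ((1 - s) * 1 + s * 2)⁻¹ := by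
      refine Ell.norm_le_of_tsum_le (inv_pos.2 hc) (summableAt_of_mem_hSpace x (inv_pos.2 hc)) ?_
      refine le_of_eq_of_le (tsum_congr fun n => ?_) hlt.le
      rw [div_inv_eq_mul, mul_comm]
    rw [hx', le_inv_comm₀ one_pos hc] at h3
    linarith

/-! ## Coordinate projections -/

variable (M)

theorem Ell.e_mem_hSpace (n : ℕ) : Ell.e M n ∈ M.hSpace :=
  Submodule.le_topologicalClosure _ (Submodule.subset_span ⟨n, rfl⟩)

/-- The `n`-th coordinate functional on `h_M`. -/
noncomputable def hCoord (n : ℕ) : M.hSpace →L[ℝ] ℝ :=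
  ((LinearMap.proj n ∘ₗ Ell.seq M) ∘ₗ M.hSpace.subtype).mkContinuous
    (Ell.exists_abs_seq_le M).choose fun x => (Ell.exists_abs_seq_le M).choose_spec x n

theorem hCoord_apply (n : ℕ) (x : M.hSpace) : M.hCoord n x = Ell.seq M x n := rfl

/-- The coordinate projection of `h_M` onto the span of the `eₙ`, `n ∈ A`. -/
noncomputable def hProj (A : Finset ℕ) : M.hSpace →L[ℝ] M.hSpace :=
  ∑ n ∈ A, (M.hCoord n).smulRight (⟨Ell.e M n, Ell.e_mem_hSpace M n⟩ : M.hSpace)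

theorem seq_hProj (A : Finset ℕ) (x : M.hSpace) (n : ℕ) :
    Ell.seq M (M.hProj A x) n = if n ∈ A then Ell.seq M x n else 0 := by
  rw [← hCoord_apply, hProj, _root_.sum_apply, map_sum]
  simp [hCoord_apply, Ell.seq_e, Pi.single_apply]

theorem hSpace_ext {x y : M.hSpace} (h : ∀ n, Ell.seq M x n = Ell.seq M y n) : x = y :=
  Subtype.ext (Ell.seq_injective M (funext h))

theorem finiteDimensional_range_hProj (A : Finset ℕ) :
    FiniteDimensional ℝ (LinearMap.range (M.hProj A : M.hSpace →ₗ[ℝ] M.hSpace)) := by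
  classical
  let s : Finset M.hSpace := A.image fun n => ⟨Ell.e M n, Ell.e_mem_hSpace M n⟩
  refine Submodule.finiteDimensional_of_le (S₂ := Submodule.span ℝ (s : Set M.hSpace)) ?_
  rintro _ ⟨x, rfl⟩
  change M.hProj A x ∈ _
  rw [hProj, _root_.sum_apply]
  exact Submodule.sum_mem _ fun n hn => Submodule.smul_mem _ _
    (Submodule.subset_span (Finset.mem_coe.2 (Finset.mem_image_of_mem _ hn)))

theorem norm_hProj_le (A : Finset ℕ) (x : M.hSpace) : ‖M.hProj A x‖ ≤ ‖x‖ :=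
  Ell.norm_le_norm fun n => by
    change |Ell.seq M (M.hProj A x) n| ≤ |Ell.seq M x n|
    rw [seq_hProj]
    split_ifs
    · exact le_rfl
    · simp

theorem hProj_hProj (A B : Finset ℕ) (x : M.hSpace) :
    M.hProj A (M.hProj B x) = M.hProj (A ∩ B) x :=
  M.hSpace_ext fun n => by
    simp only [seq_hProj, Finset.mem_inter]
    split_ifs <;> tauto

/-- Once `k` passes the support of a finite approximation `z`, the remainder of `x` after projection
is coordinatewise dominated by `x - z`, so monotonicity of the norm suffices. -/
theorem tendsto_hProj (x : M.hSpace) :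
    Tendsto (fun m => M.hProj (Finset.range m) x) atTop (𝓝 x) := by
  refine Metric.tendsto_atTop.2 fun ε hε => ?_
  obtain ⟨z, ⟨m, hm⟩, hz⟩ := exists_finite_approx x hε
  refine ⟨m, fun k hk => ?_⟩
  rw [dist_comm, dist_eq_norm]
  refine lt_of_le_of_lt (Ell.norm_le_norm fun n => ?_) hz
  change |Ell.seq M (x - M.hProj (Finset.range k) x : M.Ell) n| ≤ _
  rw [map_sub, map_sub, Pi.sub_apply, Pi.sub_apply, seq_hProj]
  split_ifs with hn
  · simp
  · rw [hm n (by simp at hn; omega)]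

/-! ### Norming by finitely many coordinates -/

/-- Every nonzero vector of `h_M` is nearly normed by a coordinate projection. -/
theorem exists_norm_lt_mul_norm_hProj {K : ℝ} (hM : M.NonDegenerate) (hK0 : 0 < K) {w : ℕ → ℝ}
    (hw : StrictAnti w) (hw1 : Tendsto w atTop (𝓝 1))
    (h : ∀ᶠ n : ℕ in atTop, ∀ s : ℝ, 0 ≤ s → n * M s ≤ 1 → w n * M s ≤ (w n - 1) * M (K * s))
    (x : M.hSpace) (hx : x ≠ 0) :
    ∃ A : Finset ℕ, ‖x‖ < w (A.card + 1) * ‖M.hProj A x‖ := by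
  classical
  have hwpos : ∀ n, 1 < w n := fun n =>
    (hw.antitone.le_of_tendsto hw1 (n + 1)).trans_lt (hw n.lt_succ_self)
  wlog hx1 : ‖x‖ = 1 generalizing x
  · have hx0 : 0 < ‖x‖ := norm_pos_iff.2 hx
    have hn : ‖‖x‖⁻¹ • x‖ = 1 := by rw [norm_smul, norm_inv, norm_norm, inv_mul_cancel₀ hx0.ne']
    obtain ⟨A, hA⟩ := this (‖x‖⁻¹ • x) (smul_ne_zero (inv_ne_zero hx0.ne') hx) hn
    refine ⟨A, ?_⟩
    rw [hn, map_smul, norm_smul, norm_inv, norm_norm, mul_left_comm, ← div_eq_inv_mul,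
      one_lt_div hx0] at hA
    exact hA
  set a := Ell.seq M (x : M.Ell) with ha
  have hsum1 : ∑' n, M |a n| = 1 := tsum_eq_one x hx1
  have hs1 : Summable fun n => M |a n| := by
    simpa [SummableAt] using summableAt_of_mem_hSpace x one_pos
  have hsK : Summable fun n => M (K * |a n|) :=
    (summableAt_of_mem_hSpace x (inv_pos.2 hK0)).congr fun n => by rw [div_inv_eq_mul, mul_comm]
  -- `B` leaves less than 1 of the modular at scale `K`; for large `n` the set `A` below contains
  -- all of `B` that contributes.
  obtain ⟨B, hB⟩ : ∃ B : Finset ℕ, ∑' n, M (K * |a n|) - 1 < ∑ n ∈ B, M (K * |a n|) :=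
    (hsK.hasSum.eventually (lt_mem_nhds (sub_one_lt _))).exists
  have hlarge : ∀ᶠ n : ℕ in atTop, ∀ i ∈ B, M (K * |a i|) ≠ 0 → 1 < n * M |a i| := by
    refine (Filter.eventually_all_finset B).2 fun i _ => ?_
    by_cases hi : a i = 0
    · simp [hi, M.map_zero]
    · have hpos := hM _ (abs_pos.2 hi)
      filter_upwards [eventually_gt_atTop ⌈1 / M |a i|⌉₊] with n hn _
      rw [← div_lt_iff₀ hpos]
      exact Nat.lt_of_ceil_lt hn
  obtain ⟨n, hn, hnB, hn0⟩ := (h.and (hlarge.and (eventually_gt_atTop 0))).exists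
  have hn0' : (0 : ℝ) < n := Nat.cast_pos.2 hn0
  have hfin : {i | 1 < n * M |a i|}.Finite := by
    have h1 := (hs1.mul_left (n : ℝ)).tendsto_cofinite_zero.eventually (gt_mem_nhds one_pos)
    refine (Filter.eventually_cofinite.1 h1).subset fun i hi => ?_
    exact not_lt.2 (le_of_lt hi)
  set A := hfin.toFinset with hA
  have hmemA : ∀ i, i ∈ A ↔ 1 < n * M |a i| := fun i => by simp [hA]
  have hA1 : ∑ i ∈ A, M |a i| ≤ 1 :=
    (hs1.sum_le_tsum A fun i _ => M.nonneg (abs_nonneg _)).trans_eq hsum1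
  -- Markov's inequality: each element of `A` takes more than 1 / n of a total of at most 1. For
  -- empty `A` the inequality is not strict, and `n > 0` is needed.
  have hcard : A.card + 1 ≤ n := by
    rcases A.eq_empty_or_nonempty with he | hne
    · rw [he, Finset.card_empty]; exact hn0
    have h1 : ∑ _i ∈ A, (1 : ℝ) < ∑ i ∈ A, n * M |a i| :=
      Finset.sum_lt_sum_of_nonempty hne fun i hi => (hmemA i).1 hi
    rw [← Finset.mul_sum, Finset.sum_const, nsmul_one] at h1
    have h2 : (A.card : ℝ) < n := h1.trans_le (mul_le_of_le_one_right hn0'.le hA1)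
    exact_mod_cast h2
  have htailK : ∑' i : ↥((A : Set ℕ)ᶜ), M (K * |a i|) < 1 := by
    have h1 : ∑ i ∈ B, M (K * |a i|) ≤ ∑ i ∈ A, M (K * |a i|) := by
      rw [← Finset.sum_filter_ne_zero]
      refine Finset.sum_le_sum_of_subset_of_nonneg (fun i hi => ?_)
        fun i _ _ => M.nonneg (mul_nonneg hK0.le (abs_nonneg _))
      exact (hmemA i).2 (hnB i (Finset.mem_filter.1 hi).1 (Finset.mem_filter.1 hi).2)
    have h2 := hsK.sum_add_tsum_compl (s := A)
    linarith
  have htail : w n * ∑' i : ↥((A : Set ℕ)ᶜ), M |a i| ≤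
      (w n - 1) * ∑' i : ↥((A : Set ℕ)ᶜ), M (K * |a i|) := by
    rw [← tsum_mul_left, ← tsum_mul_left]
    refine ((hs1.subtype _).mul_left _).tsum_le_tsum (fun i => hn _ (abs_nonneg _) ?_)
      ((hsK.subtype _).mul_left _)
    exact not_lt.1 fun hi => i.2 ((hmemA i).2 hi)
  -- The total is 1 and the weighted tail is below `w n - 1`, so more than 1 remains on `A`.
  have hhead : 1 < w n * ∑ i ∈ A, M |a i| := by
    have h1 := hs1.sum_add_tsum_compl (s := A)
    have h2 := mul_lt_mul_of_pos_left htailK (sub_pos.2 (hwpos n))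
    have h3 : w n * ∑ i ∈ A, M |a i| + w n * ∑' i : ↥((A : Set ℕ)ᶜ), M |a i| = w n := by
      rw [← mul_add, h1, hsum1, mul_one]
    linarith
  -- For ρ < 1, convexity and M(0) = 0 give M(t) ≤ ρ M(t / ρ), so on the unit ball the modular is at
  -- most the norm.
  have hnormA : ∑ i ∈ A, M |a i| ≤ ‖M.hProj A x‖ := by
    refine le_of_forall_gt_imp_ge_of_dense fun ρ hρ => ?_
    have hρ0 : 0 < ρ := (norm_nonneg _).trans_lt hρ
    rcases le_or_gt 1 ρ with h1 | h1
    · exact hA1.trans h1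
    have h2 := Ell.sum_le_one (x := (M.hProj A x : M.Ell)) hρ A
    calc ∑ i ∈ A, M |a i| ≤ ∑ i ∈ A, ρ * M (|Ell.seq M (M.hProj A x) i| / ρ) :=
          Finset.sum_le_sum fun i hi => by
            rw [seq_hProj, if_pos hi, ← ha]
            have h3 := M.map_mul_le hρ0.le h1.le (div_nonneg (abs_nonneg (a i)) hρ0.le)
            rwa [mul_div_cancel₀ _ hρ0.ne'] at h3
      _ ≤ ρ := by
          rw [← Finset.mul_sum]
          exact mul_le_of_le_one_right hρ0.le h2
  refine ⟨A, ?_⟩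
  rw [hx1]
  exact hhead.trans_le (mul_le_mul (hw.antitone hcard) hnormA
    (Finset.sum_nonneg fun i _ => M.nonneg (abs_nonneg _)) (zero_lt_one.trans (hwpos _)).le)

end OrliczFunction

theorem mainTheorem2 (M : OrliczFunction) (hM : M.NonDegenerate)
    (hK : ∃ K : ℝ, 0 < K ∧ Tendsto (fun t : ℝ => M (K * t) / M t) (𝓝[>] 0) atTop) :
    IsIsomorphicallyPolyhedral M.hSpace := by
  obtain ⟨K, hK0, hK⟩ := hK
  obtain ⟨w, hw, hw1, h⟩ := M.exists_rate hM hK0 hK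
  exact isIsomorphicallyPolyhedral_of_projections M.hProj M.finiteDimensional_range_hProj
    M.norm_hProj_le M.hProj_hProj M.tendsto_hProj w hw hw1
    (M.exists_norm_lt_mul_norm_hProj hM hK0 hw hw1 h)
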